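/- Let $G=(V,E)$ be a finite simple undirected graph with $n=|V|$ vertices. It is called $(D,c)$-uniform if every vertex degree lies between $D$ and $cD$, where $D>0$. The standard random walk moves at each step to a uniformly random neighbour; for a stationary distribution $\mu$ of it, the $\delta$-mixing time is the smallest $s$ such that, from every starting vertex, the distribution $\mu'$ of the walk after $s$ steps satisfies $\|\mu-\mu'\|_\infty\le\delta$. Let $T=T(n)$ denote the $\delta$-mixing time for $\delta=\frac{1}{(2cn)^2}$ (assumed to exist). Given integers $m,t$, take $m$ independent random walks, each starting at a uniformly random vertex and having length $t$ (that is, $t$ steps), and let $A$ be the $m\times|E|$ matrix whose entry $A_{i,e}$ is the number of times that the $i$-th walk traverses the edge $e$. Theorem. There are absolute constants $K_0,a,K>0$ and $\alpha\in(0,1)$, and a sequence $\varepsilon_n\to0$, such that the following holds. Let $k\ge1$, let $G$ be a $(D,c)$-uniform graph on $n\geq 1$ vertices with finite mixing time $T$ as above and with $D\ge K_0c^2kT^2$, and let $t=\left\lfloor a\,\frac{nD}{c^3kT}\right\rfloor$. Suppose that $$m>\max_{1\le k_1\le k}\;-\frac{k_1\left(1+\log\frac{n^2}{k_1}\right)}{\log\left(1-\alpha\frac{k_1}{c^4kT^2}\right)},\qquad\text{or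 that}\qquad m\ge K\,c^4T^2k\log n .$$ Then with probability at least $1-\varepsilon_n$ both of the following hold: 1. for every nonempty set $H$ of at most $k$ edges, some row of $A$ has exactly one nonzero entry in the columns indexed by $H$; 2. every vector $x\in\mathbb R^{E}$ with at most $k/2$ nonzero entries is the unique sparsest solution $z$ of $Az=Ax$: every $z\ne x$ with $Az=Ax$ has strictly more nonzero entries than $x$. -/

import Mathlib

open Filter Topology Matrix

namespace PathSensing

section Walks

variable {V : Type*} [Fintype V] [DecidableEq V] (G : SimpleGraph V) [DecidableRel G.Adj]

/-- `G` is a `(D, c)`-uniform graph: every degree lies between `D` and `c * D`. -/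
def IsUniform (D c : ℝ) : Prop :=
  ∀ v : V, D ≤ (G.degree v : ℝ) ∧ (G.degree v : ℝ) ≤ c * D

/-- One step of the standard random walk from `v`: a uniformly random neighbour of `v`
(by convention the walk stays put at an isolated vertex). -/
noncomputable def stepPMF (v : V) : PMF V :=
  if h : (G.neighborFinset v).Nonempty then PMF.uniformOfFinset (G.neighborFinset v) h
  else PMF.pure v

/-- The transition matrix of the standard random walk. -/
noncomputable def transition : Matrix V V ℝ :=
  Matrix.of fun v u => (stepPMF G v u).toReal

/-- `μ` is a stationary distribution of the standard random walk. -/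
def IsStationary (μ : V → ℝ) : Prop :=
  (∀ v, 0 ≤ μ v) ∧ ∑ v, μ v = 1 ∧ μ ᵥ* transition G = μ

/-- `T` is the `δ`-mixing time: the smallest length `s` such that a random walk of length `s`
from any starting vertex ends with a distribution (a row of the `s`-th power of the
transition matrix) that is `δ`-close in the sup norm to the stationary distribution. -/
def IsMixingTime (δ : ℝ) (T : ℕ) : Prop :=
  ∃ μ : V → ℝ, IsStationary G μ ∧
    IsLeast {s : ℕ | ∀ v u : V, |μ u - (transition G ^ s) v u| ≤ δ} T

theorem sum_walk_weight (t : ℕ) (g : V → ENNReal) :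
    ∑ w : Fin (t + 1) → V, g (w 0) * ∏ i : Fin t, stepPMF G (w i.castSucc) (w i.succ)
      = ∑ v, g v := by
  induction t generalizing g with
  | zero =>
    simp only [Finset.univ_eq_empty, Finset.prod_empty, mul_one]
    exact Fintype.sum_equiv (Equiv.funUnique (Fin 1) V) _ _ (fun w => rfl)
  | succ t ih =>
    have h := ih (fun u => ∑ v, g v * stepPMF G v u)
    have h2 : ∑ u, ∑ v, g v * stepPMF G v u = ∑ v, g v := by
      rw [Finset.sum_comm]
      refine Finset.sum_congr rfl fun v _ => ?_
      rw [← Finset.mul_sum, ← tsum_fintype (L := SummationFilter.unconditional V), PMF.tsum_coe,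
        mul_one]
    rw [h2] at h
    rw [← h, ← (Fin.consEquiv (fun _ : Fin (t + 2) => V)).sum_comp, Fintype.sum_prod_type,
      Finset.sum_comm]
    refine Finset.sum_congr rfl fun w _ => ?_
    rw [Finset.sum_mul]
    refine Finset.sum_congr rfl fun v _ => ?_
    simp [Fin.consEquiv, Fin.prod_univ_succ, mul_assoc]

variable [Nonempty V]

/-- The law of a random walk `w 0, w 1, …, w t` of length `t` whose starting vertex is uniform
on `V`, and whose steps are those of the standard random walk. -/
noncomputable def walkPMF (t : ℕ) : PMF (Fin (t + 1) → V) :=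
  PMF.ofFintype
    (fun w => (Fintype.card V : ENNReal)⁻¹ *
      ∏ i : Fin t, stepPMF G (w i.castSucc) (w i.succ))
    (by
      rw [sum_walk_weight G t (fun _ => (Fintype.card V : ENNReal)⁻¹)]
      simp only [Finset.sum_const, Finset.card_univ, nsmul_eq_mul]
      exact ENNReal.mul_inv_cancel (by simp) (by simp))

/-- The joint law of `m` independent such walks. -/
noncomputable def walksPMF (m t : ℕ) : PMF (Fin m → Fin (t + 1) → V) :=
  PMF.ofFintype (fun W => ∏ i, walkPMF G t (W i))
    (by
      have h : ∑ w, walkPMF G t w = 1 := by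
        rw [← tsum_fintype (L := SummationFilter.unconditional _)]
        exact PMF.tsum_coe _
      have h2 := Finset.prod_univ_sum (fun _ : Fin m => Finset.univ)
        (fun (_ : Fin m) w => walkPMF G t w)
      simp only [Fintype.piFinset_univ] at h2
      rw [← h2]
      simp [h])

/-- The probability of an event about `m` independent random walks of length `t`. -/
noncomputable def walksProb (m t : ℕ) (S : Set (Fin m → Fin (t + 1) → V)) : ℝ :=
  ((walksPMF G m t).toOuterMeasure S).toReal

end Walks

section Recovery

/-- The measurement matrix of `m` walks: one row for each walk, one column for each edge, and the
entry is the number of times that the walk traverses the edge. -/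
def measurementMatrix {V : Type*} [DecidableEq V] (G : SimpleGraph V) {m t : ℕ}
    (W : Fin m → Fin (t + 1) → V) : Matrix (Fin m) G.edgeSet ℝ :=
  Matrix.of fun i e =>
    ((Finset.univ.filter fun j : Fin t =>
      s(W i j.castSucc, W i j.succ) = (e : Sym2 V)).card : ℝ)

variable {ι E : Type*} [Fintype E]

/-- Every nonempty set `H` of at most `k` columns has a row with exactly one nonzero entry
in the columns of `H`. -/
def HasSingletonRows (A : Matrix ι E ℝ) (k : ℕ) : Prop :=
  ∀ H : Finset E, H.Nonempty → H.card ≤ k → ∃ i, ∃! e, e ∈ H ∧ A i e ≠ 0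

/-- The number of nonzero entries of a vector. -/
noncomputable def numNonzero (x : E → ℝ) : ℕ := {e | x e ≠ 0}.ncard

/-- `x` is the unique sparsest vector among all `z` with the same measurements `A z = A x`. -/
def IsUniqueSparsest (A : Matrix ι E ℝ) (x : E → ℝ) : Prop :=
  ∀ z : E → ℝ, A *ᵥ z = A *ᵥ x → z ≠ x → numNonzero x < numNonzero z

/-- Every vector with at most `k / 2` nonzero entries is recovered from its measurements. -/
def RecoversHalf (A : Matrix ι E ℝ) (k : ℕ) : Prop :=
  ∀ x : E → ℝ, (numNonzero x : ℝ) ≤ (k : ℝ) / 2 → IsUniqueSparsest A x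

end Recovery

end PathSensing

set_option linter.unusedSectionVars false

namespace PathSensing

/-! ### The random walk as a Markov chain, and mixing towards the degree distribution. -/

section Chain

variable {V : Type*} [Fintype V] [DecidableEq V] (G : SimpleGraph V) [DecidableRel G.Adj]

/-! Fix a set `H` of `l ≤ k` edges and let `X` count the steps of one walk along `H`. Each of the
first `T` steps crosses `H` with probability at most `l / D`. Each later step does so with
probability between `l / (c n D)` and `3 l / (n D)`, because the walk is then close to the
distribution proportional to degrees (`IsUniform.mixed_step_bounds`). For the chosen `t`, the mean
of `X` is at most `1/4` from every start, and at least of order `l / (c⁴ k T)`. By the Markov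
property the mean of `X.choose 2` is at most `1/4` of that of `X`, and `X - 2 * X.choose 2` is at
most the indicator of `X = 1`, so `X = 1` has probability at least half the mean of `X`
(`IsUniform.le_prob_crossings_eq_one`).

A walk with `X = 1` yields a row with a single nonzero entry in `H`. By independence all `m` walks
fail with probability at most `(1 - p) ^ (2 * m)`, where `2 p` is a lower bound for the probability
of `X = 1`. The condition on `m` makes one factor `(1 - p) ^ m` cancel the number of sets of size
`l`; the other leaves at most `n⁻ˡ`, and the sum over `l` is at most `2 / n`. Recovery then follows
deterministically (`HasSingletonRows.recoversHalf`). -/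

theorem transition_nonneg (v u : V) : 0 ≤ transition G v u := ENNReal.toReal_nonneg

theorem sum_transition (v : V) : ∑ u, transition G v u = 1 := by
  have h := (stepPMF G v).tsum_coe
  rw [tsum_fintype] at h
  simp only [transition, of_apply]
  rw [← ENNReal.toReal_sum (fun u _ => PMF.apply_ne_top _ _), h, ENNReal.toReal_one]

theorem transition_apply {v : V} (hv : 0 < G.degree v) (u : V) :
    transition G v u = if G.Adj v u then (G.degree v : ℝ)⁻¹ else 0 := by
  have h : (G.neighborFinset v).Nonempty := by
    rwa [← Finset.card_pos, G.card_neighborFinset_eq_degree]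
  simp only [transition, of_apply, stepPMF, dif_pos h, PMF.uniformOfFinset_apply,
    SimpleGraph.mem_neighborFinset, SimpleGraph.card_neighborFinset_eq_degree]
  split_ifs <;> simp

theorem transition_pow_nonneg (s : ℕ) (v u : V) : 0 ≤ (transition G ^ s) v u := by
  induction s generalizing u with
  | zero => simp only [pow_zero, one_apply]; split_ifs <;> norm_num
  | succ s ih =>
    rw [pow_succ, mul_apply]
    exact Finset.sum_nonneg fun w _ => mul_nonneg (ih w) (transition_nonneg G w u)

theorem sum_transition_pow (s : ℕ) (v : V) : ∑ u, (transition G ^ s) v u = 1 := by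
  induction s with
  | zero => simp [one_apply]
  | succ s ih =>
    simp_rw [pow_succ, mul_apply]
    rw [Finset.sum_comm]
    simp_rw [← Finset.mul_sum, sum_transition, mul_one, ih]

/-- Averaging the rows of the `T`-step transition matrix keeps them close to `μ`. -/
theorem abs_sub_vecMul_le {μ : V → ℝ} {δ : ℝ} {T : ℕ}
    (h : ∀ v u : V, |μ u - (transition G ^ T) v u| ≤ δ) {ρ : V → ℝ} (h0 : ∀ v, 0 ≤ ρ v)
    (h1 : ∑ v, ρ v = 1) (u : V) : |μ u - (ρ ᵥ* (transition G ^ T)) u| ≤ δ := by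
  have : μ u - (ρ ᵥ* (transition G ^ T)) u = ∑ v, ρ v * (μ u - (transition G ^ T) v u) := by
    simp only [vecMul, dotProduct, mul_sub, Finset.sum_sub_distrib, ← Finset.sum_mul, h1, one_mul]
  rw [this]
  calc |∑ v, ρ v * (μ u - (transition G ^ T) v u)|
      ≤ ∑ v, |ρ v * (μ u - (transition G ^ T) v u)| := Finset.abs_sum_le_sum_abs _ _
    _ ≤ ∑ v, ρ v * δ := Finset.sum_le_sum fun v _ => by
        rw [abs_mul, abs_of_nonneg (h0 v)]
        exact mul_le_mul_of_nonneg_left (h v u) (h0 v)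
    _ = δ := by rw [← Finset.sum_mul, h1, one_mul]

/-- The sum of all degrees. -/
def degreeSum : ℝ := ∑ v, (G.degree v : ℝ)

/-- Every edge carries the same flow `1 / degreeSum G` in each direction. This gives an explicit
stationary law, so uniqueness of `μ` is never needed. -/
theorem degree_vecMul_transition (hd : ∀ v, 0 < G.degree v) :
    (fun v => (G.degree v : ℝ) / degreeSum G) ᵥ* transition G
      = fun v => (G.degree v : ℝ) / degreeSum G := by
  ext u
  simp only [vecMul, dotProduct]
  have : ∀ v, (G.degree v : ℝ) / degreeSum G * transition G v u
      = if G.Adj u v then 1 / degreeSum G else 0 := by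
    intro v
    have hv : (G.degree v : ℝ) ≠ 0 := by exact_mod_cast (hd v).ne'
    rw [transition_apply G (hd v)]
    by_cases h : G.Adj u v
    · rw [if_pos h, if_pos h.symm]
      field_simp
    · rw [if_neg h, if_neg fun h' => h h'.symm, mul_zero]
  simp_rw [this]
  rw [← Finset.sum_filter, Finset.sum_const, ← SimpleGraph.neighborFinset_eq_filter,
    G.card_neighborFinset_eq_degree, nsmul_eq_mul, mul_one_div]

theorem vecMul_pow_eq {ρ : V → ℝ} (h : ρ ᵥ* transition G = ρ) (s : ℕ) :
    ρ ᵥ* (transition G ^ s) = ρ := by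
  induction s with
  | zero => simp
  | succ s ih => rw [pow_succ, ← vecMul_vecMul, ih, h]

/-- After at least `T` steps the walk is close to the distribution proportional to degrees. -/
theorem abs_transition_pow_sub_degree_le [Nonempty V] (hd : ∀ v, 0 < G.degree v) {δ : ℝ} {T : ℕ}
    (hT : IsMixingTime G δ T) {s : ℕ} (hs : T ≤ s) (v u : V) :
    |(transition G ^ s) v u - (G.degree u : ℝ) / degreeSum G| ≤ 2 * δ := by
  obtain ⟨μ, -, hμ, -⟩ := hT
  have hS : 0 < degreeSum G :=
    Finset.sum_pos (fun v _ => by exact_mod_cast hd v) Finset.univ_nonempty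
  -- Both the degree law and the row at time `s ≥ T` are averages of rows of the `T`-step matrix, so
  -- each is within `δ` of `μ`.
  have h1 := abs_sub_vecMul_le G hμ (ρ := fun v => (G.degree v : ℝ) / degreeSum G)
    (fun v => by positivity) (by rw [← Finset.sum_div]; exact div_self hS.ne') u
  rw [vecMul_pow_eq G (degree_vecMul_transition G hd)] at h1
  have h2 := abs_sub_vecMul_le G hμ (ρ := (transition G ^ (s - T)) v)
    (transition_pow_nonneg G _ v) (sum_transition_pow G _ v) u
  have h3 : ((transition G ^ (s - T)) v ᵥ* (transition G ^ T)) u = (transition G ^ s) v u := by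
    conv_rhs => rw [← Nat.sub_add_cancel hs, pow_add, mul_apply]
    rfl
  rw [h3] at h2
  rw [abs_le] at *
  constructor <;> linarith [h1.1, h1.2, h2.1, h2.2]

end Chain

/-! ### First and second moments of the number of crossings. -/

section Moments

variable {V : Type*} [Fintype V] [DecidableEq V] (G : SimpleGraph V) [DecidableRel G.Adj]

/-- The expectation of `f` over the walks of length `t` started at `v`. -/
noncomputable def expectFrom (t : ℕ) (v : V) (f : (Fin (t + 1) → V) → ℝ) : ℝ :=
  ∑ w : Fin t → V, (∏ i : Fin t, transition G ((Fin.cons v w : Fin (t + 1) → V) i.castSucc)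
    ((Fin.cons v w : Fin (t + 1) → V) i.succ)) * f (Fin.cons v w)

theorem expectFrom_zero (v : V) (f : (Fin 1 → V) → ℝ) :
    expectFrom G 0 v f = f (fun _ => v) := by
  simp only [expectFrom, Finset.univ_unique, Finset.univ_eq_empty, Finset.prod_empty, one_mul,
    Finset.sum_singleton]
  congr 1
  ext i
  fin_cases i
  rfl

theorem expectFrom_succ (t : ℕ) (v : V) (f : (Fin (t + 2) → V) → ℝ) :
    expectFrom G (t + 1) v f
      = ∑ u, transition G v u * expectFrom G t u (fun w => f (Fin.cons v w)) := by
  unfold expectFrom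
  rw [← (Fin.consEquiv (fun _ : Fin (t + 1) => V)).sum_comp, Fintype.sum_prod_type]
  refine Finset.sum_congr rfl fun u _ => ?_
  rw [Finset.mul_sum]
  refine Finset.sum_congr rfl fun w _ => ?_
  simp [Fin.consEquiv, Fin.prod_univ_succ, mul_assoc]

theorem expectFrom_mono {t : ℕ} (v : V) {f g : (Fin (t + 1) → V) → ℝ} (h : ∀ w, f w ≤ g w) :
    expectFrom G t v f ≤ expectFrom G t v g :=
  Finset.sum_le_sum fun _ _ => mul_le_mul_of_nonneg_left (h _)
    (Finset.prod_nonneg fun _ _ => transition_nonneg G _ _)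

theorem expectFrom_add {t : ℕ} (v : V) (f g : (Fin (t + 1) → V) → ℝ) :
    expectFrom G t v (fun w => f w + g w) = expectFrom G t v f + expectFrom G t v g := by
  simp [expectFrom, mul_add, Finset.sum_add_distrib]

theorem expectFrom_const_mul {t : ℕ} (v : V) (r : ℝ) (f : (Fin (t + 1) → V) → ℝ) :
    expectFrom G t v (fun w => r * f w) = r * expectFrom G t v f := by
  simp only [expectFrom, Finset.mul_sum]
  exact Finset.sum_congr rfl fun _ _ => by ring

theorem expectFrom_one (t : ℕ) (v : V) : expectFrom G t v (fun _ => 1) = 1 := by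
  induction t generalizing v with
  | zero => rw [expectFrom_zero]
  | succ t ih => simp_rw [expectFrom_succ, ih, mul_one, sum_transition]

theorem expectFrom_const (t : ℕ) (v : V) (r : ℝ) : expectFrom G t v (fun _ => r) = r := by
  have h := expectFrom_const_mul G (t := t) v r (fun _ => 1)
  rwa [expectFrom_one, mul_one] at h

variable (K : SimpleGraph V) [DecidableRel K.Adj]

/-- The number of steps of the walk `w` along edges of `K`. -/
def crossings {t : ℕ} (w : Fin (t + 1) → V) : ℕ :=
  (Finset.univ.filter fun j : Fin t => K.Adj (w j.castSucc) (w j.succ)).card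

theorem crossings_cons {t : ℕ} (v : V) (w : Fin (t + 1) → V) :
    crossings K (Fin.cons v w : Fin (t + 2) → V)
      = (if K.Adj v (w 0) then 1 else 0) + crossings K w := by
  simp only [crossings, Finset.card_filter]
  rw [Fin.sum_univ_succ]
  rfl

/-- The probability that a step from `u` is along an edge of `K`. -/
noncomputable def crossProb (u : V) : ℝ := ∑ v, if K.Adj u v then transition G u v else 0

theorem crossProb_nonneg (u : V) : 0 ≤ crossProb G K u :=
  Finset.sum_nonneg fun v _ => by split_ifs; exacts [transition_nonneg G u v, le_rfl]

variable {G K} in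
theorem crossProb_eq (hK : K ≤ G) {u : V} (hu : 0 < G.degree u) :
    crossProb G K u = K.degree u / G.degree u := by
  have : ∀ v, (if K.Adj u v then transition G u v else 0)
      = if K.Adj u v then (G.degree u : ℝ)⁻¹ else 0 := by
    intro v
    split_ifs with h
    · rw [transition_apply G hu, if_pos (hK h)]
    · rfl
  simp_rw [crossProb, this]
  rw [← Finset.sum_filter, Finset.sum_const, ← SimpleGraph.neighborFinset_eq_filter,
    K.card_neighborFinset_eq_degree, nsmul_eq_mul, div_eq_mul_inv]

theorem expectFrom_congr_head {t : ℕ} (u : V) {f g : (Fin (t + 1) → V) → ℝ}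
    (h : ∀ w, w 0 = u → f w = g w) : expectFrom G t u f = expectFrom G t u g :=
  Finset.sum_congr rfl fun w _ => by rw [h _ rfl]

theorem expectFrom_crossings_succ (t : ℕ) (v : V) :
    expectFrom G (t + 1) v (fun w => (crossings K w : ℝ))
      = crossProb G K v
        + ∑ u, transition G v u * expectFrom G t u (fun w => (crossings K w : ℝ)) := by
  rw [expectFrom_succ, crossProb, ← Finset.sum_add_distrib]
  refine Finset.sum_congr rfl fun u _ => ?_
  rw [expectFrom_congr_head G u (g := fun w => (if K.Adj v u then (1 : ℝ) else 0) + crossings K w)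
    (fun w hw => by rw [crossings_cons, hw]; push_cast; rfl),
    expectFrom_add, expectFrom_const]
  split_ifs <;> ring

theorem expectFrom_crossings (t : ℕ) (v : V) :
    expectFrom G t v (fun w => (crossings K w : ℝ))
      = ∑ s ∈ Finset.range t, ∑ u, (transition G ^ s) v u * crossProb G K u := by
  induction t generalizing v with
  | zero => simp [expectFrom_zero, crossings]
  | succ t ih =>
    rw [expectFrom_crossings_succ, Finset.sum_range_succ', add_comm]
    simp_rw [ih, pow_succ', mul_apply, Finset.mul_sum, Finset.sum_mul]
    congr 1
    · rw [Finset.sum_comm]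
      refine Finset.sum_congr rfl fun s _ => ?_
      rw [Finset.sum_comm]
      simp_rw [mul_assoc]
    · simp [one_apply]

/-- The expected number of pairs of crossings is at most `B` times the expected number of crossings,
if `B` bounds the expected number of crossings from every vertex. -/
theorem expectFrom_choose_two_le {B : ℝ} (t : ℕ)
    (hB : ∀ s < t, ∀ v, expectFrom G s v (fun w => (crossings K w : ℝ)) ≤ B) (v : V) :
    expectFrom G t v (fun w => ((crossings K w).choose 2 : ℝ))
      ≤ B * expectFrom G t v (fun w => (crossings K w : ℝ)) := by
  induction t generalizing v with
  | zero => simp [expectFrom_zero, crossings]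
  | succ t ih =>
    rw [expectFrom_crossings_succ, expectFrom_succ, crossProb, ← Finset.sum_add_distrib,
      Finset.mul_sum]
    refine Finset.sum_le_sum fun u _ => ?_
    -- A crossing at the first step forms one new pair with each later crossing, and `hB` bounds the
    -- mean number of those.
    rw [expectFrom_congr_head G u (g := fun w => ((crossings K w).choose 2 : ℝ)
      + (if K.Adj v u then (1 : ℝ) else 0) * crossings K w)
      (fun w hw => by
        rw [crossings_cons, hw]
        split_ifs
        · rw [add_comm 1, Nat.choose_succ_succ' _ 1, Nat.choose_one_right]
          push_cast
          ring
        · simp),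
      expectFrom_add, expectFrom_const_mul]
    have h1 := mul_le_mul_of_nonneg_left (ih (fun s hs => hB s (by omega)) u)
      (transition_nonneg G v u)
    have h2 := mul_le_mul_of_nonneg_left (hB t (by omega) u) (transition_nonneg G v u)
    split_ifs <;> linarith

/-- Second moment bound for the probability of exactly one crossing. -/
theorem le_expectFrom_crossings_eq_one {B : ℝ} (t : ℕ)
    (hB : ∀ s < t, ∀ v, expectFrom G s v (fun w => (crossings K w : ℝ)) ≤ B) (v : V) :
    (1 - 2 * B) * expectFrom G t v (fun w => (crossings K w : ℝ))
      ≤ expectFrom G t v (fun w => if crossings K w = 1 then 1 else 0) := by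
  have h := expectFrom_choose_two_le G K t hB v
  -- Pointwise, `X - 2 * X.choose 2 = X * (2 - X)`, which is `1` at `X = 1` and nonpositive at every
  -- other natural number.
  have h2 : expectFrom G t v (fun w => (crossings K w : ℝ) + (-2) * ((crossings K w).choose 2 : ℝ))
      ≤ expectFrom G t v (fun w => if crossings K w = 1 then 1 else 0) := by
    refine expectFrom_mono G v fun w => ?_
    rw [Nat.cast_choose_two]
    rcases Nat.lt_trichotomy (crossings K w) 1 with h | h | h
    · have : crossings K w = 0 := by omega
      simp [this]
    · simp [h]
    · rw [if_neg (by omega)]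
      have : (2 : ℝ) ≤ crossings K w := by exact_mod_cast h
      nlinarith
  rw [expectFrom_add, expectFrom_const_mul] at h2
  linarith

end Moments
end PathSensing
namespace PathSensing
-- Estimates for uniform graphs.
section Bounds

variable {V : Type*} [Fintype V] [DecidableEq V] {G : SimpleGraph V} [DecidableRel G.Adj]
  {D c : ℝ}

theorem IsUniform.degree_pos (hG : IsUniform G D c) (hD : 0 < D) (v : V) : 0 < G.degree v := by
  have := (hG v).1
  exact_mod_cast hD.trans_le this

theorem IsUniform.one_le [Nonempty V] (hG : IsUniform G D c) (hD : 0 < D) : 1 ≤ c := by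
  obtain ⟨v⟩ := ‹Nonempty V›
  have h := (hG v).1.trans (hG v).2
  by_contra! h'
  nlinarith

theorem IsUniform.le_degreeSum (hG : IsUniform G D c) : Fintype.card V * D ≤ degreeSum G := by
  have := Finset.card_nsmul_le_sum Finset.univ (fun v => (G.degree v : ℝ)) D fun v _ => (hG v).1
  simpa [degreeSum] using this

theorem IsUniform.degreeSum_le (hG : IsUniform G D c) :
    degreeSum G ≤ c * (Fintype.card V * D) := by
  have := Finset.sum_le_card_nsmul Finset.univ (fun v => (G.degree v : ℝ)) (c * D)
    fun v _ => (hG v).2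
  simp only [Finset.card_univ, nsmul_eq_mul] at this
  unfold degreeSum
  linarith

theorem IsUniform.lt_card [Nonempty V] (hG : IsUniform G D c) : D < Fintype.card V := by
  obtain ⟨v⟩ := ‹Nonempty V›
  have h := G.degree_lt_card_verts v
  exact (hG v).1.trans_lt (by exact_mod_cast h)

variable {K : SimpleGraph V} [DecidableRel K.Adj]

theorem IsUniform.crossProb_le (hG : IsUniform G D c) (hD : 0 < D) (hK : K ≤ G) (u : V) :
    crossProb G K u ≤ K.edgeFinset.card / D := by
  rw [crossProb_eq hK (hG.degree_pos hD u)]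
  have h : (K.degree u : ℝ) ≤ K.edgeFinset.card := by exact_mod_cast K.degree_le_card_edgeFinset u
  exact div_le_div₀ (by positivity) h hD (hG u).1

theorem IsUniform.step_le (hG : IsUniform G D c) (hD : 0 < D) (hK : K ≤ G) (s : ℕ) (v : V) :
    ∑ u, (transition G ^ s) v u * crossProb G K u ≤ K.edgeFinset.card / D :=
  calc _ ≤ ∑ u, (transition G ^ s) v u * (K.edgeFinset.card / D) :=
        Finset.sum_le_sum fun u _ => mul_le_mul_of_nonneg_left (hG.crossProb_le hD hK u)
          (transition_pow_nonneg G s v u)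
    _ = _ := by rw [← Finset.sum_mul, sum_transition_pow, one_mul]

theorem sum_degree_mul (K : SimpleGraph V) [DecidableRel K.Adj] (r : ℝ) :
    ∑ u, (K.degree u : ℝ) * r = 2 * K.edgeFinset.card * r := by
  rw [← Finset.sum_mul]
  congr 1
  exact_mod_cast K.sum_degrees_eq_twice_card_edges

/-- The error `2 * δ` per vertex is weighted by `crossProb G K u ≤ K.degree u / D`, so the handshake
lemma bounds the total without a factor `n`. -/
theorem IsUniform.abs_mixed_step_sub_le [Nonempty V] (hG : IsUniform G D c) (hD : 0 < D)
    (hK : K ≤ G) {δ : ℝ} {T : ℕ} (hT : IsMixingTime G δ T) {s : ℕ} (hs : T ≤ s) (v : V) :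
    |∑ u, (transition G ^ s) v u * crossProb G K u - 2 * K.edgeFinset.card / degreeSum G|
      ≤ 2 * K.edgeFinset.card * (2 * δ / D) := by
  have hδ : 0 ≤ 2 * δ :=
    (abs_nonneg _).trans (abs_transition_pow_sub_degree_le G (hG.degree_pos hD) hT hs v v)
  have e : ∑ u, (transition G ^ s) v u * crossProb G K u - 2 * K.edgeFinset.card / degreeSum G
      = ∑ u, ((transition G ^ s) v u - G.degree u / degreeSum G) * crossProb G K u := by
    simp_rw [sub_mul, Finset.sum_sub_distrib]
    congr 1
    rw [div_eq_mul_inv, ← sum_degree_mul]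
    refine Finset.sum_congr rfl fun u _ => ?_
    have hu : (G.degree u : ℝ) ≠ 0 := by exact_mod_cast (hG.degree_pos hD u).ne'
    rw [crossProb_eq hK (hG.degree_pos hD u)]
    field_simp
  rw [e, ← sum_degree_mul]
  refine (Finset.abs_sum_le_sum_abs _ _).trans (Finset.sum_le_sum fun u _ => ?_)
  rw [abs_mul, abs_of_nonneg (crossProb_nonneg G K u), crossProb_eq hK (hG.degree_pos hD u)]
  calc _ ≤ 2 * δ * ((K.degree u : ℝ) / D) :=
        mul_le_mul (abs_transition_pow_sub_degree_le G (hG.degree_pos hD) hT hs v u)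
          (div_le_div_of_nonneg_left (by positivity) hD (hG u).1) (by positivity) hδ
    _ = _ := by ring

theorem IsUniform.mixed_step_bounds [Nonempty V] (hG : IsUniform G D c) (hD : 0 < D)
    (hK : K ≤ G) {T : ℕ} (hT : IsMixingTime G (1 / (2 * c * Fintype.card V) ^ 2) T) {s : ℕ}
    (hs : T ≤ s) (v : V) :
    K.edgeFinset.card / (c * (Fintype.card V * D))
        ≤ ∑ u, (transition G ^ s) v u * crossProb G K u ∧
      ∑ u, (transition G ^ s) v u * crossProb G K u
        ≤ 3 * K.edgeFinset.card / (Fintype.card V * D) := by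
  have h := hG.abs_mixed_step_sub_le hD hK hT hs v
  have hc := hG.one_le hD
  have hn : (1 : ℝ) ≤ Fintype.card V := by exact_mod_cast Fintype.card_pos
  have hS1 := hG.le_degreeSum
  have hS2 := hG.degreeSum_le
  set n : ℝ := ((Fintype.card V : ℕ) : ℝ)
  set S := degreeSum G
  set x : ℝ := ((K.edgeFinset.card : ℕ) : ℝ)
  have hx : 0 ≤ x := Nat.cast_nonneg _
  have hcn : 1 ≤ c * n := one_le_mul_of_one_le_of_one_le hc hn
  have hnD : 0 < n * D := by positivity
  have hS : 0 < S := hnD.trans_le hS1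
  -- The choice of `δ` keeps the error below half of the main term `2 * x / S`.
  have herr : 2 * x * (2 * (1 / (2 * c * n) ^ 2) / D) ≤ x / (c * (n * D)) := by
    have : 2 * x * (2 * (1 / (2 * c * n) ^ 2) / D) = x / ((c * n) * (c * n * D)) := by
      field_simp
    rw [this]
    refine div_le_div_of_nonneg_left hx (by positivity) ?_
    rw [← mul_assoc]
    exact le_mul_of_one_le_left (by positivity) hcn
  have hlo : 2 * x / (c * (n * D)) ≤ 2 * x / S :=
    div_le_div_of_nonneg_left (by positivity) hS hS2
  have hhi : 2 * x / S ≤ 2 * x / (n * D) := div_le_div_of_nonneg_left (by positivity) hnD hS1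
  have hcmp : x / (c * (n * D)) ≤ x / (n * D) :=
    div_le_div_of_nonneg_left hx hnD (le_mul_of_one_le_left hnD.le hc)
  rw [abs_le] at h
  have e1 : 2 * x / (c * (n * D)) = 2 * (x / (c * (n * D))) := by ring
  have e2 : 2 * x / (n * D) = 2 * (x / (n * D)) := by ring
  have e3 : 3 * x / (n * D) = 3 * (x / (n * D)) := by ring
  constructor <;> linarith [h.1, h.2]

theorem IsUniform.expectFrom_crossings_le [Nonempty V] (hG : IsUniform G D c) (hD : 0 < D)
    (hK : K ≤ G) {T : ℕ} (hT : IsMixingTime G (1 / (2 * c * Fintype.card V) ^ 2) T) (t : ℕ)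
    (v : V) :
    expectFrom G t v (fun w => (crossings K w : ℝ))
      ≤ T * (K.edgeFinset.card / D) + t * (3 * K.edgeFinset.card / (Fintype.card V * D)) := by
  rw [expectFrom_crossings]
  set A : ℝ := K.edgeFinset.card / D
  set B : ℝ := 3 * K.edgeFinset.card / (Fintype.card V * D)
  have hA : 0 ≤ A := by positivity
  have hB : 0 ≤ B := by positivity
  calc _ ≤ ∑ s ∈ Finset.range t, ((if s < T then A else 0) + B) := by
        refine Finset.sum_le_sum fun s _ => ?_
        split_ifs with h
        · linarith [hG.step_le hD hK s v]
        · linarith [(hG.mixed_step_bounds hD hK hT (not_lt.1 h) v).2]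
    _ ≤ T * A + t * B := by
        rw [Finset.sum_add_distrib, ← Finset.sum_filter, Finset.sum_const, Finset.sum_const,
          Finset.card_range, nsmul_eq_mul, nsmul_eq_mul]
        gcongr
        calc _ ≤ (Finset.range T).card := Finset.card_le_card fun s hs => by
              simpa using (Finset.mem_filter.1 hs).2
          _ = T := Finset.card_range T

theorem IsUniform.le_expectFrom_crossings [Nonempty V] (hG : IsUniform G D c) (hD : 0 < D)
    (hK : K ≤ G) {T : ℕ} (hT : IsMixingTime G (1 / (2 * c * Fintype.card V) ^ 2) T) (t : ℕ)
    (v : V) :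
    ((t : ℝ) - T) * (K.edgeFinset.card / (c * (Fintype.card V * D)))
      ≤ expectFrom G t v (fun w => (crossings K w : ℝ)) := by
  rw [expectFrom_crossings]
  have hc := hG.one_le hD
  have hn : (0 : ℝ) < Fintype.card V := by exact_mod_cast Fintype.card_pos
  set B : ℝ := K.edgeFinset.card / (c * (Fintype.card V * D))
  have hB : 0 ≤ B := by positivity
  calc _ ≤ ∑ s ∈ Finset.Ico T t, B := by
        rw [Finset.sum_const, Nat.card_Ico, nsmul_eq_mul]
        refine mul_le_mul_of_nonneg_right ?_ hB
        have : (t : ℝ) ≤ (t - T : ℕ) + T := by exact_mod_cast le_tsub_add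
        linarith
    _ ≤ ∑ s ∈ Finset.Ico T t, ∑ u, (transition G ^ s) v u * crossProb G K u :=
        Finset.sum_le_sum fun s hs =>
          (hG.mixed_step_bounds hD hK hT (Finset.mem_Ico.1 hs).1 v).1
    _ ≤ _ := Finset.sum_le_sum_of_subset_of_nonneg
        (fun s hs => Finset.mem_range.2 (Finset.mem_Ico.1 hs).2)
        fun s _ _ => Finset.sum_nonneg fun u _ =>
          mul_nonneg (transition_pow_nonneg G s v u) (crossProb_nonneg G K u)

/-- From every vertex, a walk of length `⌊n D / (24 c³ k T)⌋` crosses `K` exactly once with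
probability at least `|E(K)| / (96 c⁴ k T)`. -/
theorem IsUniform.le_prob_crossings_eq_one [Nonempty V] (hG : IsUniform G D c) (hD : 0 < D)
    (hK : K ≤ G) {k T t : ℕ} (hT : IsMixingTime G (1 / (2 * c * Fintype.card V) ^ 2) T)
    (hk : K.edgeFinset.card ≤ k) (hk1 : 1 ≤ k) (hT1 : 1 ≤ T)
    (hDk : 10 * c ^ 2 * k * (T : ℝ) ^ 2 ≤ D)
    (ht : t = ⌊1 / 24 * (Fintype.card V * D / (c ^ 3 * k * T))⌋₊) (v : V) :
    K.edgeFinset.card / (96 * c ^ 4 * k * T)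
      ≤ expectFrom G t v (fun w => if crossings K w = 1 then 1 else 0) := by
  have hc := hG.one_le hD
  have hn : (0 : ℝ) < Fintype.card V := by exact_mod_cast Fintype.card_pos
  have hnD := hG.lt_card
  have hup := fun s v => hG.expectFrom_crossings_le hD hK hT s v
  have hlow := hG.le_expectFrom_crossings hD hK hT t v
  set n : ℝ := ((Fintype.card V : ℕ) : ℝ)
  have hkx : (K.edgeFinset.card : ℝ) ≤ k := by exact_mod_cast hk
  have hk1' : (1 : ℝ) ≤ k := by exact_mod_cast hk1
  have hT1' : (1 : ℝ) ≤ T := by exact_mod_cast hT1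
  set x : ℝ := ((K.edgeFinset.card : ℕ) : ℝ)
  have hx : 0 ≤ x := Nat.cast_nonneg _
  set y : ℝ := 1 / 24 * (n * D / (c ^ 3 * k * T)) with hy
  have hy0 : 0 ≤ y := by positivity
  have hty : (t : ℝ) ≤ y := ht ▸ Nat.floor_le hy0
  have hyt : y < t + 1 := ht ▸ Nat.lt_floor_add_one y
  have hkT : c ^ 2 * k * T ^ 2 ≤ D := by
    have : 0 ≤ c ^ 2 * k * (T : ℝ) ^ 2 := by positivity
    linarith
  -- Since `D < n`, the lower bound on `D` applies to both factors of `n * D`; the constant `10`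
  -- suffices as `10 * 10 ≥ 4 * 24`.
  have hy4 : 4 * T ≤ y := by
    rw [hy, mul_div_assoc', le_div_iff₀ (by positivity)]
    have h1 : (10 * c ^ 2 * k * (T : ℝ) ^ 2) * (10 * c ^ 2 * k * (T : ℝ) ^ 2) ≤ n * D :=
      mul_le_mul (hDk.trans hnD.le) hDk (by positivity) hn.le
    have h2 : c ^ 3 * k * (T : ℝ) ^ 2 ≤ c ^ 4 * k ^ 2 * (T : ℝ) ^ 4 := by
      gcongr <;> first | assumption | norm_num
      exact le_self_pow₀ hk1' (by norm_num)
    nlinarith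
  -- This absorbs both the unmixed steps and the rounding, giving `t - T ≥ y / 2`.
  have hT4 : (T : ℝ) + 1 ≤ y / 2 := by linarith
  -- The unmixed steps contribute at most `1/10` and the stationary rate at most `1/8`; then `1 - 2
  -- * B = 1/2`.
  have hB : ∀ s < t, ∀ v, expectFrom G s v (fun w => (crossings K w : ℝ)) ≤ 1 / 4 := by
    intro s hs v
    refine (hup s v).trans ?_
    have h1 : T * (x / D) ≤ 1 / 10 := by
      rw [mul_div_assoc', div_le_iff₀ hD]
      have : x * T ≤ c ^ 2 * k * (T : ℝ) ^ 2 := by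
        calc x * T ≤ k * T ^ 2 :=
              mul_le_mul hkx (le_self_pow₀ hT1' (by norm_num)) (by positivity) (by positivity)
          _ ≤ c ^ 2 * (k * T ^ 2) :=
              le_mul_of_one_le_left (by positivity) (one_le_pow₀ hc)
          _ = _ := by ring
      linarith
    have h2 : s * (3 * x / (n * D)) ≤ 1 / 8 := by
      have hs' : (s : ℝ) ≤ y := le_trans (by exact_mod_cast hs.le) hty
      calc s * (3 * x / (n * D)) ≤ y * (3 * k / (n * D)) := by gcongr
        _ = 1 / 8 * (1 / (c ^ 3 * T)) := by rw [hy]; field_simp; ring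
        _ ≤ 1 / 8 * 1 := by
            gcongr
            rw [div_le_one (by positivity)]
            exact one_le_mul_of_one_le_of_one_le (one_le_pow₀ hc) hT1'
        _ = 1 / 8 := by norm_num
    linarith
  have h := le_expectFrom_crossings_eq_one G K t hB v
  refine le_trans ?_ h
  have h3 : x / (48 * c ^ 4 * k * T) ≤ expectFrom G t v (fun w => (crossings K w : ℝ)) := by
    refine le_trans ?_ hlow
    calc x / (48 * c ^ 4 * k * T) = y / 2 * (x / (c * (n * D))) := by
          rw [hy]; field_simp; ring
      _ ≤ (t - T) * (x / (c * (n * D))) := by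
          gcongr
          linarith
  have e : x / (96 * c ^ 4 * k * T) = x / (48 * c ^ 4 * k * T) / 2 := by field_simp; ring
  rw [e]
  linarith

/-- At time `0`, starting from `u` or from a neighbour would give `u` mass `1` or `0`; both cannot
be within `1/4` of `μ u`. -/
theorem IsMixingTime.pos [Nonempty V] {T : ℕ} (hG : IsUniform G D c) (hD : 0 < D)
    (hT : IsMixingTime G (1 / (2 * c * Fintype.card V) ^ 2) T) : 1 ≤ T := by
  by_contra! h
  obtain rfl : T = 0 := by omega
  obtain ⟨μ, -, hμ, -⟩ := hT
  obtain ⟨v⟩ := ‹Nonempty V›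
  obtain ⟨u, hu⟩ := (G.degree_pos_iff_exists_adj v).1 (hG.degree_pos hD v)
  have h1 := hμ v u
  have h2 := hμ u u
  have hne : v ≠ u := hu.ne
  have hc := hG.one_le hD
  have hn : (1 : ℝ) ≤ Fintype.card V := by exact_mod_cast Fintype.card_pos
  have hδ : 1 / (2 * c * Fintype.card V : ℝ) ^ 2 ≤ 1 / 4 := by
    apply div_le_div_of_nonneg_left <;> nlinarith [one_le_mul_of_one_le_of_one_le hc hn]
  simp only [pow_zero, one_apply, if_neg hne, if_true] at h1 h2
  rw [abs_le] at h1 h2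
  linarith [h1.2, h2.1]

end Bounds
end PathSensing
namespace PathSensing
-- Independence and the union bound.
section Probability

variable {V : Type*} [Fintype V] [DecidableEq V] (G : SimpleGraph V) [DecidableRel G.Adj]
  [Nonempty V]

theorem sum_walkPMF_mul (t : ℕ) (f : (Fin (t + 1) → V) → ℝ) :
    ∑ w, (walkPMF G t w).toReal * f w
      = (Fintype.card V : ℝ)⁻¹ * ∑ v, expectFrom G t v f := by
  rw [← (Fin.consEquiv (fun _ : Fin (t + 1) => V)).sum_comp, Fintype.sum_prod_type,
    Finset.mul_sum]
  refine Finset.sum_congr rfl fun v _ => ?_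
  rw [expectFrom, Finset.mul_sum]
  refine Finset.sum_congr rfl fun w _ => ?_
  simp [Fin.consEquiv, walkPMF, transition, ENNReal.toReal_mul, ENNReal.toReal_prod, mul_assoc]

theorem sum_walkPMF (t : ℕ) : ∑ w, (walkPMF G t w).toReal = 1 := by
  have h := (walkPMF G t).tsum_coe
  rw [tsum_fintype] at h
  rw [← ENNReal.toReal_sum (fun u _ => PMF.apply_ne_top _ _), h, ENNReal.toReal_one]

/-- A bound from every starting vertex bounds the probability of the complementary event. -/
theorem sum_walkPMF_filter_not_le {t : ℕ} {p : ℝ} (P : (Fin (t + 1) → V) → Prop)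
    [DecidablePred P] (h : ∀ v, p ≤ expectFrom G t v (fun w => if P w then 1 else 0)) :
    ∑ w ∈ Finset.univ.filter (fun w => ¬ P w), (walkPMF G t w).toReal ≤ 1 - p := by
  have hn : (0 : ℝ) < Fintype.card V := by exact_mod_cast Fintype.card_pos
  have h1 : p ≤ ∑ w ∈ Finset.univ.filter P, (walkPMF G t w).toReal := by
    have h2 := sum_walkPMF_mul G t (fun w => if P w then 1 else 0)
    simp only [mul_ite, mul_one, mul_zero] at h2
    rw [Finset.sum_filter, h2, inv_mul_eq_div, le_div_iff₀ hn]
    have h3 := Finset.card_nsmul_le_sum Finset.univ _ p fun v _ => h v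
    rw [Finset.card_univ, nsmul_eq_mul] at h3
    linarith
  have h4 := Finset.sum_filter_add_sum_filter_not Finset.univ P
    (fun w => (walkPMF G t w).toReal)
  rw [sum_walkPMF] at h4
  linarith

theorem walksProb_forall_mem (m t : ℕ) (F : Finset (Fin (t + 1) → V)) :
    walksProb G m t {W | ∀ i, W i ∈ F} = (∑ w ∈ F, (walkPMF G t w).toReal) ^ m := by
  have h : {W : Fin m → Fin (t + 1) → V | ∀ i, W i ∈ F}
      = ↑(Fintype.piFinset fun _ : Fin m => F) := by ext; simp
  have h2 := Finset.prod_univ_sum (fun _ : Fin m => F) (fun _ w => walkPMF G t w)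
  rw [walksProb, h, PMF.toOuterMeasure_apply_finset]
  simp only [walksPMF, PMF.ofFintype_apply]
  rw [← h2, Finset.prod_const, Finset.card_univ, Fintype.card_fin, ENNReal.toReal_pow,
    ENNReal.toReal_sum (fun u _ => PMF.apply_ne_top _ _)]

theorem walksProb_ne_top (m t : ℕ) (S : Set (Fin m → Fin (t + 1) → V)) :
    (walksPMF G m t).toOuterMeasure S ≠ ⊤ := by
  classical
  rw [PMF.toOuterMeasure_apply_fintype]
  refine ENNReal.sum_ne_top.2 fun W _ => ?_
  by_cases h : W ∈ S <;> simp [h, PMF.apply_ne_top]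

/-- Union bound for the failure of the event `S`. -/
theorem one_sub_sum_le_walksProb {κ : Type*} (m t : ℕ) (S : Set (Fin m → Fin (t + 1) → V))
    (I : Finset κ) (B : κ → Set (Fin m → Fin (t + 1) → V))
    (h : ∀ W, W ∉ S → ∃ i ∈ I, W ∈ B i) :
    1 - ∑ i ∈ I, walksProb G m t (B i) ≤ walksProb G m t S := by
  have h0 : (walksPMF G m t).toOuterMeasure Set.univ = 1 :=
    (PMF.toOuterMeasure_apply_eq_one_iff _ _).2 (Set.subset_univ _)
  have h1 : (1 : ENNReal) ≤ (walksPMF G m t).toOuterMeasure S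
      + ∑ i ∈ I, (walksPMF G m t).toOuterMeasure (B i) := by
    rw [← h0]
    calc _ ≤ (walksPMF G m t).toOuterMeasure (S ∪ ⋃ i ∈ I, B i) := by
          refine MeasureTheory.measure_mono fun W _ => ?_
          by_cases hW : W ∈ S
          · exact Or.inl hW
          · obtain ⟨i, hi, hWi⟩ := h W hW
            exact Or.inr (Set.mem_biUnion hi hWi)
      _ ≤ _ := (MeasureTheory.measure_union_le _ _).trans
          (add_le_add_right (MeasureTheory.measure_biUnion_finset_le I B) _)
  have h2 := ENNReal.toReal_mono (ENNReal.add_ne_top.2 ⟨walksProb_ne_top G m t S,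
    ENNReal.sum_ne_top.2 fun i _ => walksProb_ne_top G m t (B i)⟩) h1
  rw [ENNReal.toReal_add (walksProb_ne_top G m t S)
    (ENNReal.sum_ne_top.2 fun i _ => walksProb_ne_top G m t (B i)),
    ENNReal.toReal_sum fun i _ => walksProb_ne_top G m t (B i), ENNReal.toReal_one] at h2
  unfold walksProb
  linarith

end Probability

/-! ### From singleton rows to sparse recovery, and from crossings to singleton rows. -/

section Deterministic

/-- A competitor `z` no less sparse than `x` would make `z - x` a nonzero kernel vector with support
of size at most `k`. The row isolating one entry of that support has nonzero product with `z - x`.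
-/
theorem HasSingletonRows.recoversHalf {ι E : Type*} [Fintype E] {A : Matrix ι E ℝ} {k : ℕ}
    (hA : HasSingletonRows A k) : RecoversHalf A k := by
  classical
  intro x hx z hz hne
  by_contra! hle
  have hcard : ∀ y : E → ℝ, numNonzero y = (Finset.univ.filter fun e => y e ≠ 0).card := by
    intro y
    rw [numNonzero, ← Set.ncard_coe_finset]
    simp
  set H : Finset E := Finset.univ.filter fun e => (z - x) e ≠ 0
  have hH : H ⊆ (Finset.univ.filter fun e => z e ≠ 0) ∪ Finset.univ.filter fun e => x e ≠ 0 := by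
    intro e he
    simp only [H, Finset.mem_filter, Finset.mem_univ, true_and, Pi.sub_apply, Finset.mem_union]
      at he ⊢
    by_contra! h
    exact he (by rw [h.1, h.2, sub_zero])
  have h1 := (Finset.card_le_card hH).trans (Finset.card_union_le _ _)
  rw [← hcard z, ← hcard x] at h1
  have h2 : H.card ≤ k := by
    have h3 : (H.card : ℝ) ≤ numNonzero z + numNonzero x := by exact_mod_cast h1
    have h4 : (numNonzero z : ℝ) ≤ numNonzero x := by exact_mod_cast hle
    have : (H.card : ℝ) ≤ k := by linarith
    exact_mod_cast this
  have h3 : H.Nonempty := by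
    obtain ⟨e, he⟩ := Function.ne_iff.1 hne
    exact ⟨e, by simpa [H, sub_eq_zero] using he⟩
  obtain ⟨i, e, ⟨heH, hAe⟩, huniq⟩ := hA H h3 h2
  have h4 : (A *ᵥ (z - x)) i = 0 := by rw [mulVec_sub, hz, sub_self, Pi.zero_apply]
  rw [mulVec, dotProduct, Finset.sum_eq_single e] at h4
  · exact (mul_ne_zero hAe (Finset.mem_filter.1 heH).2) h4
  · intro e' _ hne'
    by_cases hA' : A i e' = 0
    · rw [hA', zero_mul]
    · by_cases hz' : (z - x) e' = 0
      · rw [hz', mul_zero]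
      · exact absurd (huniq e' ⟨Finset.mem_filter.2 ⟨Finset.mem_univ _, hz'⟩, hA'⟩) hne'
  · simp

variable {V : Type*} [DecidableEq V] {G : SimpleGraph V}

/-- The graph with edge set `H`. -/
abbrev edgeGraph (H : Finset G.edgeSet) : SimpleGraph V :=
  SimpleGraph.fromEdgeSet (H.map (Function.Embedding.subtype _) : Finset (Sym2 V))

theorem edgeGraph_adj (H : Finset G.edgeSet) (u v : V) :
    (edgeGraph H).Adj u v ↔ ∃ e ∈ H, s(u, v) = (e : Sym2 V) := by
  simp only [edgeGraph, SimpleGraph.fromEdgeSet_adj, Finset.mem_coe, Finset.mem_map]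
  constructor
  · rintro ⟨⟨e, he, h⟩, -⟩
    exact ⟨e, he, h.symm⟩
  · rintro ⟨e, he, h⟩
    have : G.Adj u v := by
      have := e.2
      rwa [← h, SimpleGraph.mem_edgeSet] at this
    exact ⟨⟨e, he, h.symm⟩, this.ne⟩

theorem edgeGraph_le (H : Finset G.edgeSet) : edgeGraph H ≤ G := by
  intro u v h
  obtain ⟨e, -, h⟩ := (edgeGraph_adj H u v).1 h
  have := e.2
  rwa [← h, SimpleGraph.mem_edgeSet] at this

theorem card_edgeFinset_edgeGraph [Fintype V] (H : Finset G.edgeSet)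
    [Fintype (edgeGraph H).edgeSet] : (edgeGraph H).edgeFinset.card = H.card := by
  rw [← Finset.card_map (Function.Embedding.subtype _)]
  congr 1
  ext e
  induction e with | h u v
  rw [SimpleGraph.mem_edgeFinset, SimpleGraph.mem_edgeSet, edgeGraph_adj]
  simp only [Finset.mem_map]
  exact exists_congr fun e => and_congr_right fun _ => eq_comm

/-- A walk with exactly one step in `H` gives a row with exactly one nonzero entry in `H`. -/
theorem existsUnique_of_crossings_eq_one {m t : ℕ} (W : Fin m → Fin (t + 1) → V) (i : Fin m)
    (H : Finset G.edgeSet) [DecidableRel (edgeGraph H).Adj]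
    (h : crossings (edgeGraph H) (W i) = 1) :
    ∃! e, e ∈ H ∧ measurementMatrix G W i e ≠ 0 := by
  have hne : ∀ e, measurementMatrix G W i e ≠ 0 ↔
      ∃ j : Fin t, s(W i j.castSucc, W i j.succ) = (e : Sym2 V) := by
    intro e
    simp [measurementMatrix, Finset.filter_eq_empty_iff]
  obtain ⟨j, hj⟩ := Finset.card_eq_one.1 h
  have hmem : ∀ j', (edgeGraph H).Adj (W i j'.castSucc) (W i j'.succ) ↔ j' = j := by
    intro j'
    have := Finset.ext_iff.1 hj j'
    simpa using this
  obtain ⟨e, he, hje⟩ := (edgeGraph_adj H _ _).1 ((hmem j).2 rfl)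
  refine ⟨e, ⟨he, (hne e).2 ⟨j, hje⟩⟩, ?_⟩
  rintro e' ⟨he', hA⟩
  obtain ⟨j', hj'⟩ := (hne e').1 hA
  have := (hmem j').1 ((edgeGraph_adj H _ _).2 ⟨e', he', hj'⟩)
  subst this
  exact Subtype.ext (hj'.symm.trans hje)

end Deterministic

/-! ### Numerical estimates for the union bound. -/

section Numeric

/-- This is `(e * n² / l) ^ l`, from `N ^ l / l!` and `l ^ l / l! ≤ e ^ l`. -/
theorem choose_le_exp {N n l : ℕ} (hN : N ≤ n ^ 2) (hn : 1 ≤ n) (hl : 1 ≤ l) :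
    (N.choose l : ℝ) ≤ Real.exp (l * (1 + Real.log ((n : ℝ) ^ 2 / l))) := by
  have hl' : (0 : ℝ) < l := by exact_mod_cast hl
  have hn' : (0 : ℝ) < n := by exact_mod_cast hn
  have h1 := Nat.choose_le_pow_div (α := ℝ) l N
  have h2 := Real.pow_div_factorial_le_exp (x := (l : ℝ)) hl'.le l
  have h3 : (N : ℝ) ≤ (n : ℝ) ^ 2 := by exact_mod_cast hN
  rw [mul_add, mul_one, Real.exp_add, ← Real.log_pow, Real.exp_log (by positivity)]
  calc (N.choose l : ℝ) ≤ (N : ℝ) ^ l / l.factorial := h1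
    _ ≤ ((n : ℝ) ^ 2) ^ l / l.factorial := by gcongr
    _ = (l : ℝ) ^ l / l.factorial * ((n : ℝ) ^ 2 / l) ^ l := by
        rw [div_pow]; field_simp
    _ ≤ _ := by gcongr

/-- The contribution of the sets of `l` edges to the union bound. -/
theorem choose_mul_pow_le {N n l m : ℕ} {p : ℝ} (hN : N ≤ n ^ 2) (hl : 1 ≤ l) (hln : l ≤ n)
    (hp1 : p < 1) (hm : (1 - p) ^ m ≤ Real.exp (-(l * (1 + Real.log ((n : ℝ) ^ 2 / l))))) :
    (N.choose l : ℝ) * ((1 - p) ^ 2) ^ m ≤ (1 / (n : ℝ)) ^ l := by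
  have hl' : (0 : ℝ) < l := by exact_mod_cast hl
  have hln' : (l : ℝ) ≤ n := by exact_mod_cast hln
  have hn' : (0 : ℝ) < n := hl'.trans_le hln'
  have h1 := choose_le_exp hN (hl.trans hln) hl
  set L := l * (1 + Real.log ((n : ℝ) ^ 2 / l)) with hL
  have hq : 0 ≤ (1 - p) ^ m := pow_nonneg (by linarith) _
  calc (N.choose l : ℝ) * ((1 - p) ^ 2) ^ m = N.choose l * ((1 - p) ^ m) ^ 2 := by
        rw [← pow_mul, ← pow_mul, mul_comm 2 m]
    _ ≤ Real.exp L * Real.exp (-L) ^ 2 := by gcongr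
    _ = Real.exp (-L) := by rw [← Real.exp_nat_mul, ← Real.exp_add]; congr 1; push_cast; ring
    _ ≤ Real.exp (-(l * Real.log n)) := by
        have : Real.log n ≤ Real.log ((n : ℝ) ^ 2 / l) := by
          refine Real.log_le_log hn' ?_
          rw [le_div_iff₀ hl', sq]
          gcongr
        rw [Real.exp_le_exp, hL]
        nlinarith
    _ = _ := by
        rw [← mul_neg, ← Real.log_inv, ← Real.log_pow, Real.exp_log (by positivity), one_div]

theorem sum_one_div_pow_le {n : ℕ} (hn : 2 ≤ n) (k : ℕ) :
    ∑ l ∈ Finset.Icc 1 k, (1 / (n : ℝ)) ^ l ≤ 2 / n := by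
  have hn' : (2 : ℝ) ≤ n := by exact_mod_cast hn
  -- The subtracted term leaves room for the tail, so that the induction closes using `1 / n ≤ 1 /
  -- 2`.
  have h : ∀ k : ℕ, ∑ l ∈ Finset.Icc 1 k, (1 / (n : ℝ)) ^ l ≤ 2 / n - 2 * (1 / (n : ℝ)) ^ (k + 1) := by
    intro k
    induction k with
    | zero =>
      have e : 2 / (n : ℝ) = 2 * (1 / n) := by ring
      simp [e]
    | succ k ih =>
      rw [Finset.sum_Icc_succ_top (by omega), pow_succ _ (k + 1)]
      have h1 : 1 / (n : ℝ) ≤ 1 / 2 := div_le_div_of_nonneg_left (by norm_num) (by norm_num) hn'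
      have h2 : 0 ≤ (1 / (n : ℝ)) ^ (k + 1) := by positivity
      nlinarith
  have h2 : 0 ≤ (1 / (n : ℝ)) ^ (k + 1) := by positivity
  linarith [h k]

end Numeric
end PathSensing
namespace PathSensing

section Numeric

theorem pow_le_exp_neg_of_neg_div_log_lt {p A : ℝ} {m : ℕ} (hp0 : 0 < p) (hp1 : p < 1)
    (h : -(A / Real.log (1 - p)) < m) : (1 - p) ^ m ≤ Real.exp (-A) := by
  have hlog : Real.log (1 - p) < 0 := Real.log_neg (by linarith) (by linarith)
  rw [← div_neg, div_lt_iff₀ (by linarith)] at h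
  rw [← Real.exp_log (show 0 < 1 - p by linarith), ← Real.exp_nat_mul, Real.exp_le_exp]
  linarith

theorem pow_le_exp_neg_of_le_mul {p A : ℝ} {m : ℕ} (hp1 : p < 1) (h : A ≤ m * p) :
    (1 - p) ^ m ≤ Real.exp (-A) :=
  calc (1 - p) ^ m ≤ Real.exp (-p) ^ m :=
        pow_le_pow_left₀ (by linarith) (Real.one_sub_le_exp_neg p) m
    _ ≤ Real.exp (-A) := by
        rw [← Real.exp_nat_mul, Real.exp_le_exp]
        linarith

theorem one_add_log_le {n l : ℕ} (hn : 2 ≤ n) (hl : 1 ≤ l) :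
    1 + Real.log ((n : ℝ) ^ 2 / l) ≤ 4 * Real.log n := by
  have hn' : (2 : ℝ) ≤ n := by exact_mod_cast hn
  have hl' : (1 : ℝ) ≤ l := by exact_mod_cast hl
  have h1 : Real.log ((n : ℝ) ^ 2 / l) ≤ 2 * Real.log n := by
    have : Real.log ((n : ℝ) ^ 2) = 2 * Real.log n := by rw [Real.log_pow]; norm_num
    rw [← this]
    exact Real.log_le_log (by positivity) (div_le_self (by positivity) hl')
  have h2 := Real.log_two_gt_d9
  have h3 := Real.log_le_log (by norm_num) hn'
  linarith

end Numeric

theorem card_edgeSet_le_sq {V : Type*} [Fintype V] (G : SimpleGraph V) [Fintype G.edgeSet] :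
    Fintype.card G.edgeSet ≤ Fintype.card V ^ 2 := by
  rw [← SimpleGraph.edgeFinset_card]
  refine G.card_edgeFinset_le_card_choose_two.trans ?_
  exact Nat.choose_le_pow _ _

end PathSensing

/-! ### The main theorem. -/

theorem mainTheorem2 :
    ∃ K₀ a α K : ℝ, 0 < K₀ ∧ 0 < a ∧ 0 < α ∧ α < 1 ∧ 0 < K ∧
    ∃ ε : ℕ → ℝ, Tendsto ε atTop (𝓝 0) ∧
    ∀ (V : Type*) [Fintype V] [DecidableEq V] [Nonempty V]
      (G : SimpleGraph V) [DecidableRel G.Adj] (D c : ℝ) (n k T t m : ℕ),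
      n = Fintype.card V → 0 < D → 1 ≤ k →
      PathSensing.IsUniform G D c →
      PathSensing.IsMixingTime G (1 / (2 * c * n) ^ 2) T →
      K₀ * c ^ 2 * k * (T : ℝ) ^ 2 ≤ D →
      t = ⌊a * (n * D / (c ^ 3 * k * T))⌋₊ →
      ((∀ k₁ : ℕ, 1 ≤ k₁ → k₁ ≤ k →
          -(k₁ * (1 + Real.log ((n : ℝ) ^ 2 / k₁)) /
            Real.log (1 - α * (k₁ / (c ^ 4 * k * (T : ℝ) ^ 2)))) < m) ∨
        K * (c ^ 4 * (T : ℝ) ^ 2 * k * Real.log n) ≤ m) →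
      1 - ε n ≤ PathSensing.walksProb G m t
        {W | PathSensing.HasSingletonRows (PathSensing.measurementMatrix G W) k ∧
          PathSensing.RecoversHalf (PathSensing.measurementMatrix G W) k} := by
  refine ⟨10, 1 / 24, 1 / 192, 768, by norm_num, by norm_num, by norm_num, by norm_num,
    by norm_num, fun n => 2 / n, tendsto_const_div_atTop_nhds_zero_nat 2, ?_⟩
  intro V _ _ _ G _ D c n k T t m hn hD hk hG hT hDk ht hm
  classical
  subst hn
  have hT1 : 1 ≤ T := hT.pos hG hD
  have hc := hG.one_le hD
  have hk' : (1 : ℝ) ≤ k := by exact_mod_cast hk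
  have hT' : (1 : ℝ) ≤ T := by exact_mod_cast hT1
  have hn2 : 2 ≤ Fintype.card V := by
    obtain ⟨v⟩ := ‹Nonempty V›
    obtain ⟨u, hu⟩ := (G.degree_pos_iff_exists_adj v).1 (hG.degree_pos hD v)
    exact Fintype.one_lt_card_iff.2 ⟨v, u, hu.ne⟩
  have hcT : 1 ≤ c ^ 2 * (T : ℝ) ^ 2 :=
    one_le_mul_of_one_le_of_one_le (one_le_pow₀ hc) (one_le_pow₀ hT')
  have hkn : k ≤ Fintype.card V := by
    have h1 := hDk.trans hG.lt_card.le
    have h2 : (k : ℝ) ≤ Fintype.card V := by nlinarith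
    exact_mod_cast h2
  -- At most half of the single-crossing bound `l / (96 * c ^ 4 * k * T)`; this spare factor `2`
  -- supplies the square in `hbad`.
  set p : ℕ → ℝ := fun l => 1 / 192 * (l / (c ^ 4 * k * (T : ℝ) ^ 2)) with hp
  have hpow : ∀ l, 1 ≤ l → l ≤ k → p l < 1 ∧ (1 - p l) ^ m
      ≤ Real.exp (-(l * (1 + Real.log ((Fintype.card V : ℝ) ^ 2 / l)))) := by
    intro l hl hlk
    have hl' : (1 : ℝ) ≤ l := by exact_mod_cast hl
    have hlk' : (l : ℝ) ≤ k := by exact_mod_cast hlk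
    have hp0 : 0 < p l := by positivity
    have hp1 : p l < 1 := by
      have : (l : ℝ) / (c ^ 4 * k * (T : ℝ) ^ 2) ≤ 1 := by
        rw [div_le_one (by positivity)]
        have h1 : 1 ≤ c ^ 4 * (T : ℝ) ^ 2 :=
          one_le_mul_of_one_le_of_one_le (one_le_pow₀ hc) (one_le_pow₀ hT')
        nlinarith
      simp only [hp]
      linarith
    refine ⟨hp1, ?_⟩
    rcases hm with hm | hm
    · exact PathSensing.pow_le_exp_neg_of_neg_div_log_lt hp0 hp1 (hm l hl hlk)
    · refine PathSensing.pow_le_exp_neg_of_le_mul hp1 ?_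
      calc l * (1 + Real.log ((Fintype.card V : ℝ) ^ 2 / l))
          ≤ l * (4 * Real.log (Fintype.card V)) := by
            gcongr
            exact PathSensing.one_add_log_le hn2 hl
        -- Here `768 = 4 * 192`.
        _ = 768 * (c ^ 4 * (T : ℝ) ^ 2 * k * Real.log (Fintype.card V)) * p l := by
            simp only [hp]
            field_simp
            ring
        _ ≤ m * p l := by gcongr
  set F : Finset G.edgeSet → Finset (Fin (t + 1) → V) := fun H =>
    Finset.univ.filter fun w => ¬ PathSensing.crossings (PathSensing.edgeGraph H) w = 1 with hF
  set I : Finset (Σ _ : ℕ, Finset G.edgeSet) :=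
    (Finset.Icc 1 k).sigma fun l => Finset.powersetCard l Finset.univ
  have hbad : ∀ l ∈ Finset.Icc 1 k, ∀ H ∈ Finset.powersetCard l (Finset.univ : Finset G.edgeSet),
      PathSensing.walksProb G m t {W | ∀ i, W i ∈ F H} ≤ ((1 - p l) ^ 2) ^ m := by
    intro l hl H hH
    obtain ⟨hl1, hlk⟩ := Finset.mem_Icc.1 hl
    have hHl := (Finset.mem_powersetCard.1 hH).2
    have hK := PathSensing.edgeGraph_le H
    rw [PathSensing.walksProb_forall_mem]
    refine pow_le_pow_left₀ (Finset.sum_nonneg fun _ _ => ENNReal.toReal_nonneg) ?_ m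
    refine (PathSensing.sum_walkPMF_filter_not_le G _ fun v =>
      hG.le_prob_crossings_eq_one hD hK hT
        (by rw [PathSensing.card_edgeFinset_edgeGraph, hHl]; exact hlk) hk hT1 hDk ht v).trans ?_
    rw [PathSensing.card_edgeFinset_edgeGraph, hHl]
    have h1 : 2 * p l ≤ l / (96 * c ^ 4 * k * T) := by
      have e : 2 * p l = l / (96 * c ^ 4 * k * (T : ℝ) ^ 2) := by
        simp only [hp]
        field_simp
        norm_num
      rw [e]
      refine div_le_div_of_nonneg_left (by positivity) (by positivity) ?_
      gcongr
      exact le_self_pow₀ hT' (by norm_num)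
    -- Uses `1 - 2 * p l ≤ (1 - p l) ^ 2`.
    nlinarith [sq_nonneg (p l)]
  refine le_trans ?_ (PathSensing.one_sub_sum_le_walksProb G m t _ I
    (fun i => {W | ∀ j, W j ∈ F i.2}) ?_)
  · refine sub_le_sub_left ?_ 1
    rw [Finset.sum_sigma]
    refine le_trans (Finset.sum_le_sum fun l hl => ?_)
      (PathSensing.sum_one_div_pow_le hn2 k)
    obtain ⟨hl1, hlk⟩ := Finset.mem_Icc.1 hl
    refine (Finset.sum_le_card_nsmul _ _ _ (hbad l hl)).trans ?_
    rw [Finset.card_powersetCard, Finset.card_univ, nsmul_eq_mul]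
    exact PathSensing.choose_mul_pow_le (PathSensing.card_edgeSet_le_sq G) hl1 (hlk.trans hkn)
      (hpow l hl1 hlk).1 (hpow l hl1 hlk).2
  · intro W hW
    have hW' : ¬ PathSensing.HasSingletonRows (PathSensing.measurementMatrix G W) k :=
      fun h => hW ⟨h, h.recoversHalf⟩
    simp only [PathSensing.HasSingletonRows, not_forall] at hW'
    obtain ⟨H, hne, hHk, hno⟩ := hW'
    refine ⟨⟨H.card, H⟩, ?_, fun i => ?_⟩
    · simp only [I, Finset.mem_sigma, Finset.mem_Icc, Finset.mem_powersetCard]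
      exact ⟨⟨hne.card_pos, hHk⟩, Finset.subset_univ _, trivial⟩
    · simp only [hF, Finset.mem_filter, Finset.mem_univ, true_and]
      exact fun h => hno ⟨i, PathSensing.existsUnique_of_crossings_eq_one W i H h⟩
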